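/- Let $G$ be a finite simple graph on $n$ vertices in which every edge lies in exactly one triangle and every non-edge (pair of distinct non-adjacent vertices) lies in exactly one quadrilateral, where triangles, quadrilaterals and hexagons mean induced subgraphs isomorphic to the cycles $C_3$, $C_4$ and $C_6$, respectively. Then there is an integer $k\ge 0$ such that $G$ is strongly regular with parameters $(n,k,1,2)$, i.e. $G$ is $k$-regular, any two adjacent vertices have exactly one common neighbour and any two distinct non-adjacent vertices have exactly two, and the number $p_6$ of hexagons of $G$ satisfies \[ p_6=\tfrac{1}{12}\,nk(k-2)(2k^2-21k+53)+n_3, \] where $n_3$ is the number of induced subgraphs of $G$ isomorphic to the six-vertex graph that consists of two vertex-disjoint triangles $abc$ and $a'b'c'$ together with exactly two further edges $aa'$ and $bb'$. In particular, \[ p_6\ \ge\ \tfrac{1}{12}\,nk(k-2)(2k^2-21k+53). \] -/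

import Mathlib

/-- The vertex set `s` induces in `G` a subgraph isomorphic to `H`. -/
def InducesCopy {V W : Type*} (G : SimpleGraph V) (H : SimpleGraph W) (s : Set V) : Prop :=
  Nonempty (G.induce s ≃g H)

/-- The number of induced subgraphs of `G` that are isomorphic to `H`
(counted as vertex sets, for a finite graph `G`). -/
noncomputable def inducedCount {V W : Type*} (G : SimpleGraph V) (H : SimpleGraph W) : ℕ :=
  {s : Set V | InducesCopy G H s}.ncard

/-- Every edge lies in exactly one triangle. -/
def EdgesInUniqueTriangle {V : Type*} (G : SimpleGraph V) : Prop :=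
  ∀ u v : V, G.Adj u v →
    ∃! s : Set V, u ∈ s ∧ v ∈ s ∧ InducesCopy G (SimpleGraph.cycleGraph 3) s

/-- Every non-edge (pair of distinct non-adjacent vertices) lies in exactly one
quadrilateral, that is, in exactly one induced 4-cycle. -/
def NonEdgesInUniqueQuadrilateral {V : Type*} (G : SimpleGraph V) : Prop :=
  ∀ u v : V, u ≠ v → ¬ G.Adj u v →
    ∃! s : Set V, u ∈ s ∧ v ∈ s ∧ InducesCopy G (SimpleGraph.cycleGraph 4) s

/-- Two disjoint triangles `0 1 2` and `3 4 5` joined by exactly two disjoint edges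
`0 3` and `1 4`. -/
def doublyLinkedTriangles : SimpleGraph (Fin 6) :=
  SimpleGraph.fromEdgeSet
    {s(0, 1), s(1, 2), s(0, 2), s(3, 4), s(4, 5), s(3, 5), s(0, 3), s(1, 4)}

/-! ### Counting induced copies by labelled embeddings. -/

section InducedCopies

variable {V W : Type*} {G : SimpleGraph V} {H : SimpleGraph W}

/-! The two hypotheses say that adjacent vertices have one common neighbour and other distinct
vertices have two; regularity follows since the adjacency matrix commutes with its square.

Induced copies are counted by labelled embeddings: a hexagon has 12 labellings, two doubly linked
triangles have 4. A labelled hexagon `x p y q z r` is built from its independent triple `x, y, z`.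
If the triple has `c` common neighbours, then `c ≤ 1`, and each pair has `2 - c` common neighbours
not adjacent to the third vertex, so there are `(2 - c)^3 = 8 - 7c` frames (`card_hexFrame`). A
frame is a hexagon unless some of `pq`, `qr`, `rp` are edges. Inclusion and exclusion removes these:
all three never occur, and two given chords occur `nk(k-2)` times.

One given chord `pq` is where `n_3` enters. Such a frame is a triangle `pqy` with a path `p x r z
q`, where `xz` and `yr` are non-edges. Among all such triangles with paths, `xz` is an edge as often
as `yr` is, by `card_linkedTriangle_adj` and `card_linkedTriangle_tip_adj`. Hence "only `yr`" occurs
as often as "only `xz`", and the latter configurations are the `4 n_3` labelled doubly linked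
triangles. So each chord accounts for `2nk(k-2)(k-3) - 4 n_3` frames, and subtracting this three
times yields `+12 n_3` in `12 p_6`. -/

/-- Embeddings with a prescribed range are isomorphisms onto the induced subgraph. -/
noncomputable def embeddingRangeEquiv (s : Set V) :
    {f : H ↪g G // Set.range f = s} ≃ (H ≃g G.induce s) where
  toFun f :=
    { toEquiv := (Equiv.ofInjective f.1 f.1.injective).trans (Equiv.setCongr f.2)
      map_rel_iff' := by
        intro a b
        simp [SimpleGraph.comap_adj] }
  invFun e := ⟨(SimpleGraph.Embedding.induce s).comp e.toEmbedding, by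
    ext v
    constructor
    · rintro ⟨w, rfl⟩
      exact (e w).2
    · intro hv
      exact ⟨e.symm ⟨v, hv⟩, by simp⟩⟩
  left_inv f := rfl
  right_inv e := by ext; rfl

theorem inducesCopy_iff_exists_embedding {s : Set V} :
    InducesCopy G H s ↔ ∃ f : H ↪g G, Set.range f = s :=
  ⟨fun ⟨e⟩ => ⟨_, ((embeddingRangeEquiv s).symm e.symm).2⟩,
    fun ⟨f, hf⟩ => ⟨(embeddingRangeEquiv s ⟨f, hf⟩).symm⟩⟩

/-- Composition with an isomorphism identifies isomorphisms with automorphisms. -/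
def isoEquivAut {W' : Type*} {H' : SimpleGraph W'} (e : H ≃g H') : (H ≃g H') ≃ (H ≃g H) where
  toFun f := f.trans e.symm
  invFun f := f.trans e
  left_inv f := by ext; simp
  right_inv f := by ext; simp

/-- An embedding amounts to its range together with an isomorphism of `H` onto that range; after
fixing one such isomorphism, the others correspond to automorphisms of `H`. -/
theorem card_embedding_eq_card_aut_mul_inducedCount [Finite V] [Finite W] :
    Nat.card (H ↪g G) = inducedCount G H * Nat.card (H ≃g H) := by
  have e : (H ↪g G) ≃ {s : Set V | InducesCopy G H s} × (H ≃g H) :=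
    calc (H ↪g G)
      _ ≃ Σ s : {s : Set V // InducesCopy G H s}, {f : H ↪g G // Set.range f = s.1} :=
          { toFun := fun f => ⟨⟨Set.range f, inducesCopy_iff_exists_embedding.2 ⟨f, rfl⟩⟩, f, rfl⟩
            invFun := fun t => t.2.1
            left_inv := fun f => rfl
            right_inv := by rintro ⟨⟨s, hs⟩, f, hf⟩; dsimp only at hf; subst hf; rfl }
      _ ≃ Σ _ : {s : Set V // InducesCopy G H s}, (H ≃g H) :=
          Equiv.sigmaCongrRight fun s =>
            (embeddingRangeEquiv s.1).trans (isoEquivAut s.2.some.symm)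
      _ ≃ {s : Set V | InducesCopy G H s} × (H ≃g H) := Equiv.sigmaEquivProd _ _
  rw [Nat.card_congr e, Nat.card_prod, inducedCount, Nat.card_coe_set_eq]

/-- If no two vertices of `H` have the same neighbours, then any map that preserves and
reflects adjacency is an embedding. -/
def embeddingEquivOfTwinFree (hH : ∀ a b : W, (∀ c, H.Adj a c ↔ H.Adj b c) → a = b) :
    (H ↪g G) ≃ {f : W → V // ∀ a b, G.Adj (f a) (f b) ↔ H.Adj a b} where
  toFun f := ⟨f, fun _ _ => f.map_rel_iff⟩
  invFun f := ⟨⟨f.1, fun a b hab => hH a b fun c => by rw [← f.2, ← f.2, hab]⟩, f.2 _ _⟩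
  left_inv f := rfl
  right_inv f := rfl

end InducedCopies

/-! ### The automorphism groups of the two six-vertex graphs. -/

instance : DecidableRel doublyLinkedTriangles.Adj := fun a b => by
  unfold doublyLinkedTriangles
  rw [SimpleGraph.fromEdgeSet_adj]
  exact inferInstanceAs (Decidable (_ ∧ _))

/-- The automorphism of the hexagon that maps `0` and `1` to given adjacent vertices. -/
def hexagonAut (t : {t : Fin 6 × Fin 6 // (SimpleGraph.cycleGraph 6).Adj t.1 t.2}) :
    SimpleGraph.cycleGraph 6 ≃g SimpleGraph.cycleGraph 6 where
  toFun i := t.1.1 + (t.1.2 - t.1.1) * i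
  -- Arithmetic is modulo 6 and adjacency makes the direction `t.1.2 - t.1.1` equal to 1 or -1, so
  -- it is its own inverse.
  invFun j := (t.1.2 - t.1.1) * (j - t.1.1)
  left_inv := by
    obtain ⟨⟨a, b⟩, hab⟩ := t
    revert a b
    unfold Function.LeftInverse
    decide
  right_inv := by
    obtain ⟨⟨a, b⟩, hab⟩ := t
    revert a b
    unfold Function.RightInverse Function.LeftInverse
    decide
  map_rel_iff' := by
    obtain ⟨⟨a, b⟩, hab⟩ := t
    revert a b
    dsimp only [Equiv.coe_fn_mk]
    decide

theorem card_aut_cycleGraph_six :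
    Nat.card (SimpleGraph.cycleGraph 6 ≃g SimpleGraph.cycleGraph 6) = 12 := by
  have hbij : Function.Bijective hexagonAut := by
    constructor
    · rintro ⟨⟨a, b⟩, hab⟩ ⟨⟨a', b'⟩, hab'⟩ heq
      have h0 : a + (b - a) * 0 = a' + (b' - a') * 0 := DFunLike.congr_fun heq 0
      have h1 : a + (b - a) * 1 = a' + (b' - a') * 1 := DFunLike.congr_fun heq 1
      simp_all
    · intro e
      have hadj : ∀ {i j}, (SimpleGraph.cycleGraph 6).Adj i j →
          (SimpleGraph.cycleGraph 6).Adj (e i) (e j) := fun hij => e.map_rel_iff.2 hij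
      -- A walk that does not turn back keeps its direction, so `e 0` and `e 1` determine `e`; the
      -- 12 automorphisms are the 12 oriented edges.
      have step : ∀ a b c : Fin 6, (SimpleGraph.cycleGraph 6).Adj a b →
          (SimpleGraph.cycleGraph 6).Adj b c → a ≠ c → c = b + (b - a) := by decide
      have h2 := step _ _ _ (hadj (i := 0) (j := 1) (by decide)) (hadj (j := 2) (by decide))
        (e.injective.ne (by decide))
      have h3 := step _ _ _ (hadj (i := 1) (j := 2) (by decide)) (hadj (j := 3) (by decide))
        (e.injective.ne (by decide))
      have h4 := step _ _ _ (hadj (i := 2) (j := 3) (by decide)) (hadj (j := 4) (by decide))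
        (e.injective.ne (by decide))
      have h5 := step _ _ _ (hadj (i := 3) (j := 4) (by decide)) (hadj (j := 5) (by decide))
        (e.injective.ne (by decide))
      refine ⟨⟨(e 0, e 1), hadj (by decide)⟩, RelIso.ext fun i => ?_⟩
      change e 0 + (e 1 - e 0) * i = e i
      fin_cases i <;> simp only [Fin.reduceFinMk, h2, h3, h4, h5, Fin.zero_eta, Fin.mk_one] <;>
        generalize e 0 = a <;> generalize e 1 = b <;> revert a b <;> decide
  rw [← Nat.card_eq_of_bijective _ hbij, Nat.card_eq_fintype_card]
  decide

/-- The automorphisms of two doubly linked triangles: `s` tells whether the two linking edges are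
exchanged, and `t` whether the two triangles are. -/
def doublyLinkedTrianglesAut (s t : Bool) : doublyLinkedTriangles ≃g doublyLinkedTriangles where
  toFun i := (bif s then ![1, 0, 2, 4, 3, 5] else id) ((bif t then ![3, 4, 5, 0, 1, 2] else id) i)
  invFun i := (bif s then ![1, 0, 2, 4, 3, 5] else id) ((bif t then ![3, 4, 5, 0, 1, 2] else id) i)
  left_inv := by
    revert s t
    unfold Function.LeftInverse
    decide
  right_inv := by
    revert s t
    unfold Function.RightInverse Function.LeftInverse
    decide
  map_rel_iff' := by
    revert s t
    dsimp only [Equiv.coe_fn_mk]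
    decide

theorem card_aut_doublyLinkedTriangles :
    Nat.card (doublyLinkedTriangles ≃g doublyLinkedTriangles) = 4 := by
  have hbij : Function.Bijective fun u : Bool × Bool => doublyLinkedTrianglesAut u.1 u.2 := by
    constructor
    · intro u v heq
      -- The four automorphisms send `0` to the distinct vertices `0`, `1`, `3`, `4`.
      have h0 := DFunLike.congr_fun heq 0
      revert u v
      dsimp only [doublyLinkedTrianglesAut, RelIso.coe_fn_mk, Equiv.coe_fn_mk]
      intro u v _
      revert u v
      decide
    · intro e
      have hpos : ∀ {i j}, doublyLinkedTriangles.Adj i j → doublyLinkedTriangles.Adj (e i) (e j) :=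
        fun hij => e.map_rel_iff.2 hij
      have hneg : ∀ {i j}, ¬ doublyLinkedTriangles.Adj i j →
          ¬ doublyLinkedTriangles.Adj (e i) (e j) := fun hij h => hij (e.map_rel_iff.1 h)
      -- The adjacency conditions are interleaved with the quantifiers so that the exhaustive search
      -- is cut off early.
      have key : ∀ a b, doublyLinkedTriangles.Adj a b → ∀ c, doublyLinkedTriangles.Adj a c →
          doublyLinkedTriangles.Adj b c → ∀ d, doublyLinkedTriangles.Adj a d →
          ¬ doublyLinkedTriangles.Adj c d → ∀ f, doublyLinkedTriangles.Adj b f →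
          doublyLinkedTriangles.Adj d f → ¬ doublyLinkedTriangles.Adj c f →
          ∀ g, doublyLinkedTriangles.Adj d g → doublyLinkedTriangles.Adj f g →
          ∃ u : Bool × Bool, ∀ i, doublyLinkedTrianglesAut u.1 u.2 i = ![a, b, c, d, f, g] i := by
        decide
      obtain ⟨u, hu⟩ := key (e 0) (e 1) (hpos (by decide)) (e 2) (hpos (by decide))
        (hpos (by decide)) (e 3) (hpos (by decide)) (hneg (by decide)) (e 4) (hpos (by decide))
        (hpos (by decide)) (hneg (by decide)) (e 5) (hpos (by decide)) (hpos (by decide))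
      refine ⟨u, RelIso.ext fun i => (hu i).trans ?_⟩
      fin_cases i <;> rfl
  rw [← Nat.card_eq_of_bijective _ hbij, Nat.card_eq_fintype_card]
  decide

/-! ### From unique triangles and quadrilaterals to common neighbours. -/

section LocalStructure

variable {V : Type*} {G : SimpleGraph V}

theorem inducesCopy_cycleGraph_three {u v w : V} (huv : G.Adj u v) (huw : G.Adj u w)
    (hvw : G.Adj v w) : InducesCopy G (SimpleGraph.cycleGraph 3) {u, v, w} := by
  rw [inducesCopy_iff_exists_embedding]
  refine ⟨embeddingEquivOfTwinFree (by decide) |>.symm ⟨![u, v, w], ?_⟩, ?_⟩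
  · rw [SimpleGraph.cycleGraph_three_eq_top]
    intro a b
    fin_cases a <;> fin_cases b <;> simp [huv, huw, hvw, huv.symm, huw.symm, hvw.symm]
  · change Set.range ![u, v, w] = _
    simp only [Matrix.range_cons, Matrix.range_empty, Set.union_empty, Set.singleton_union]

theorem inducesCopy_cycleGraph_four {u v a b : V} (hne : u ≠ v) (hab : a ≠ b)
    (huv : ¬ G.Adj u v) (hnab : ¬ G.Adj a b)
    (hua : G.Adj u a) (hva : G.Adj v a) (hub : G.Adj u b) (hvb : G.Adj v b) :
    InducesCopy G (SimpleGraph.cycleGraph 4) {u, a, v, b} := by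
  rw [inducesCopy_iff_exists_embedding]
  -- Opposite vertices of a 4-cycle have the same neighbours, so injectivity does not follow from
  -- adjacency here.
  have hinj : Function.Injective ![u, a, v, b] := by
    intro i j
    have := hua.ne
    have := hva.ne
    have := hub.ne
    have := hvb.ne
    fin_cases i <;> fin_cases j <;> simp <;> grind
  refine ⟨⟨⟨![u, a, v, b], hinj⟩, ?_⟩, ?_⟩
  · intro i j
    have h : ∀ i j : Fin 4, (SimpleGraph.cycleGraph 4).Adj i j ↔ (i - j = 1 ∨ j - i = 1) := by
      decide
    rw [h]
    have huv' : ¬ G.Adj v u := fun h => huv h.symm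
    have hnab' : ¬ G.Adj b a := fun h => hnab h.symm
    fin_cases i <;> fin_cases j <;>
      simp [*, hua.symm, hva.symm, hub.symm, hvb.symm] <;> decide
  · change Set.range ![u, a, v, b] = _
    simp only [Matrix.range_cons, Matrix.range_empty, Set.union_empty, Set.singleton_union]

theorem EdgesInUniqueTriangle.exists_common (hI : EdgesInUniqueTriangle G) {u v : V}
    (huv : G.Adj u v) : ∃ w, G.Adj u w ∧ G.Adj v w := by
  obtain ⟨s, ⟨hu, hv, hs⟩, -⟩ := hI u v huv
  obtain ⟨f, rfl⟩ := inducesCopy_iff_exists_embedding.1 hs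
  obtain ⟨i, rfl⟩ := hu
  obtain ⟨j, rfl⟩ := hv
  have key : ∀ i j : Fin 3, (SimpleGraph.cycleGraph 3).Adj i j →
      ∃ l, (SimpleGraph.cycleGraph 3).Adj i l ∧ (SimpleGraph.cycleGraph 3).Adj j l := by decide
  obtain ⟨l, h1, h2⟩ := key i j (f.map_rel_iff.1 huv)
  exact ⟨f l, f.map_rel_iff.2 h1, f.map_rel_iff.2 h2⟩

theorem EdgesInUniqueTriangle.common_unique (hI : EdgesInUniqueTriangle G) {u v w w' : V}
    (huv : G.Adj u v) (hw : G.Adj u w) (hw2 : G.Adj v w) (hw' : G.Adj u w')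
    (hw2' : G.Adj v w') : w = w' := by
  have h := (hI u v huv).unique
    (y₁ := {u, v, w}) (y₂ := {u, v, w'})
    ⟨by simp, by simp, inducesCopy_cycleGraph_three huv hw hw2⟩
    ⟨by simp, by simp, inducesCopy_cycleGraph_three huv hw' hw2'⟩
  have hm : w ∈ ({u, v, w'} : Set V) := h ▸ (by simp)
  rcases hm with rfl | rfl | hm
  · exact (hw.ne rfl).elim
  · exact (hw2.ne rfl).elim
  · exact hm

theorem NonEdgesInUniqueQuadrilateral.exists_common (hII : NonEdgesInUniqueQuadrilateral G)
    {u v : V} (hne : u ≠ v) (huv : ¬ G.Adj u v) :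
    ∃ a b, a ≠ b ∧ G.Adj u a ∧ G.Adj v a ∧ G.Adj u b ∧ G.Adj v b := by
  obtain ⟨s, ⟨hu, hv, hs⟩, -⟩ := hII u v hne huv
  obtain ⟨f, rfl⟩ := inducesCopy_iff_exists_embedding.1 hs
  obtain ⟨i, rfl⟩ := hu
  obtain ⟨j, rfl⟩ := hv
  have key : ∀ i j : Fin 4, i ≠ j → ¬ (SimpleGraph.cycleGraph 4).Adj i j →
      ∃ a b, a ≠ b ∧ (SimpleGraph.cycleGraph 4).Adj i a ∧ (SimpleGraph.cycleGraph 4).Adj j a ∧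
        (SimpleGraph.cycleGraph 4).Adj i b ∧ (SimpleGraph.cycleGraph 4).Adj j b := by decide
  obtain ⟨a, b, hab, h1, h2, h3, h4⟩ :=
    key i j (fun h => hne (h ▸ rfl)) (fun h => huv (f.map_rel_iff.2 h))
  exact ⟨f a, f b, f.injective.ne hab, f.map_rel_iff.2 h1, f.map_rel_iff.2 h2,
    f.map_rel_iff.2 h3, f.map_rel_iff.2 h4⟩

theorem NonEdgesInUniqueQuadrilateral.common_eq_or (hI : EdgesInUniqueTriangle G)
    (hII : NonEdgesInUniqueQuadrilateral G) {u v a b c : V} (hne : u ≠ v) (huv : ¬ G.Adj u v)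
    (hab : a ≠ b) (hua : G.Adj u a) (hva : G.Adj v a) (hub : G.Adj u b) (hvb : G.Adj v b)
    (huc : G.Adj u c) (hvc : G.Adj v c) : c = a ∨ c = b := by
  by_contra! hc
  -- If `a` and `x` were adjacent, the edge `ax` would lie in triangles with both `u` and `v`. So a
  -- third common neighbour `c` would give a second induced quadrilateral through `u` and `v`.
  have hn : ∀ {x}, G.Adj u x → G.Adj v x → ¬ G.Adj a x := fun hux hvx h =>
    hne (hI.common_unique h hua.symm hux.symm hva.symm hvx.symm)
  have h := (hII u v hne huv).unique
    (y₁ := {u, a, v, b}) (y₂ := {u, a, v, c})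
    ⟨by simp, by simp, inducesCopy_cycleGraph_four hne hab huv (hn hub hvb) hua hva hub hvb⟩
    ⟨by simp, by simp, inducesCopy_cycleGraph_four hne hc.1.symm huv (hn huc hvc) hua hva huc hvc⟩
  have hm : c ∈ ({u, a, v, b} : Set V) := h ▸ (by simp)
  rcases hm with rfl | rfl | rfl | hm
  · exact huc.ne rfl
  · exact hc.1 rfl
  · exact hvc.ne rfl
  · exact hc.2 hm

end LocalStructure

/-! ### Strong regularity. -/

section Regularity

variable {V : Type*} [Fintype V] [DecidableEq V] {G : SimpleGraph V} [DecidableRel G.Adj]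

/-- If any two adjacent vertices have one common neighbour and any two other vertices have two,
then all degrees are equal, because the adjacency matrix commutes with its square. -/
theorem degree_eq_of_common_neighbors
    (hA : ∀ u v, G.Adj u v → Fintype.card (G.commonNeighbors u v) = 1)
    (hN : ∀ u v, u ≠ v → ¬ G.Adj u v → Fintype.card (G.commonNeighbors u v) = 2) (u v : V) :
    G.degree u = G.degree v := by
  set A : Matrix V V ℤ := G.adjMatrix ℤ with hAdef
  set D : Matrix V V ℤ := Matrix.diagonal fun w => (G.degree w : ℤ) - 2
  set J : Matrix V V ℤ := Matrix.of fun _ _ => 2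
  -- Entries of the square count common neighbours: the degree on the diagonal, 1 on edges and 2 on
  -- non-edges; every entry of `J` is 2.
  have hsq : A * A = D - A + J := by
    ext x y
    have h : (A * A) x y = Fintype.card (G.commonNeighbors x y) := by
      rw [SimpleGraph.adjMatrix_mul_apply]
      simp only [hAdef, SimpleGraph.adjMatrix_apply, Finset.sum_boole]
      rw [← Set.toFinset_card]
      congr 2
      ext w
      simp [SimpleGraph.mem_commonNeighbors, G.adj_comm w y]
    rw [h]
    by_cases hxy : x = y
    · subst hxy
      simp only [SimpleGraph.commonNeighbors, Set.inter_self, SimpleGraph.card_neighborSet_eq_degree]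
      simp [D, J, A]
    · by_cases hadj : G.Adj x y
      · simp [D, J, A, hA x y hadj, hadj, hxy]
      · simp [D, J, A, hN x y hxy hadj, hadj, hxy]
  have hcomm : A * (D - A + J) = (D - A + J) * A := by rw [← hsq, mul_assoc]
  have h := congrFun (congrFun hcomm u) v
  have hAJ : (A * J) u v = 2 * G.degree u := by
    rw [SimpleGraph.adjMatrix_mul_apply]
    simp [J, mul_comm]
  have hJA : (J * A) u v = 2 * G.degree v := by
    rw [SimpleGraph.mul_adjMatrix_apply]
    simp [J, mul_comm]
  have hAD : (A * D) u v = A u v * (G.degree v - 2) := by simp [D, Matrix.mul_diagonal]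
  have hDA : (D * A) u v = (G.degree u - 2) * A u v := by simp [D, Matrix.diagonal_mul]
  simp only [Matrix.mul_add, Matrix.mul_sub, Matrix.add_mul, Matrix.sub_mul, Matrix.add_apply,
    Matrix.sub_apply, hAJ, hJA, hAD, hDA] at h
  by_cases huv : G.Adj u v
  · have : A u v = 1 := by simp [A, huv]
    rw [this] at h
    omega
  · have : A u v = 0 := by simp [A, huv]
    rw [this] at h
    omega

theorem exists_isSRGWith (hI : EdgesInUniqueTriangle G) (hII : NonEdgesInUniqueQuadrilateral G) :
    ∃ k, G.IsSRGWith (Fintype.card V) k 1 2 := by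
  have hA : ∀ u v, G.Adj u v → Fintype.card (G.commonNeighbors u v) = 1 := by
    intro u v huv
    obtain ⟨w, hu, hv⟩ := hI.exists_common huv
    rw [Fintype.card_eq_one_iff]
    exact ⟨⟨w, hu, hv⟩, fun y => Subtype.ext (hI.common_unique huv y.2.1 y.2.2 hu hv)⟩
  have hN : ∀ u v, u ≠ v → ¬ G.Adj u v → Fintype.card (G.commonNeighbors u v) = 2 := by
    intro u v hne huv
    obtain ⟨a, b, hab, hua, hva, hub, hvb⟩ := hII.exists_common hne huv
    rw [← Set.toFinset_card, Finset.card_eq_two]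
    refine ⟨a, b, hab, ?_⟩
    ext c
    simp only [Set.mem_toFinset, SimpleGraph.mem_commonNeighbors, Finset.mem_insert,
      Finset.mem_singleton]
    constructor
    · rintro ⟨huc, hvc⟩
      exact hII.common_eq_or hI hne huv hab hua hva hub hvb huc hvc
    · rintro (rfl | rfl)
      · exact ⟨hua, hva⟩
      · exact ⟨hub, hvb⟩
  have hreg : ∃ k, G.IsRegularOfDegree k := by
    cases isEmpty_or_nonempty V with
    | inl h => exact ⟨0, fun v => h.elim v⟩
    | inr h => exact ⟨G.degree h.some, fun v => degree_eq_of_common_neighbors hA hN v _⟩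
  obtain ⟨k, hk⟩ := hreg
  exact ⟨k, rfl, hk, hA, fun u v hne huv => hN u v hne huv⟩

end Regularity

/-! ### Fibrewise counting and inclusion-exclusion. -/

section CardLemmas

variable {α β : Type*} [Fintype α] [Fintype β]

theorem card_filter_prod_eq_sum (P : α → Prop) (R : α → β → Prop) [DecidablePred P]
    [∀ a, DecidablePred (R a)] :
    Finset.card {t : α × β | P t.1 ∧ R t.1 t.2} =
      ∑ a with P a, Finset.card {b | R a b} := by
  rw [Finset.card_filter, Fintype.sum_prod_type, Finset.sum_filter]
  refine Finset.sum_congr rfl fun a _ => ?_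
  by_cases h : P a <;> simp [h]

/-- The fibre size is an integer so that values such as `k - 2` or `k - 4` avoid truncated
subtraction. -/
theorem card_filter_prod_of_const (P : α → Prop) (R : α → β → Prop) [DecidablePred P]
    [∀ a, DecidablePred (R a)] (c : ℤ)
    (h : ∀ a, P a → (Finset.card {b | R a b} : ℤ) = c) :
    (Finset.card {t : α × β | P t.1 ∧ R t.1 t.2} : ℤ) = Finset.card {a | P a} * c := by
  rw [card_filter_prod_eq_sum, Nat.cast_sum,
    Finset.sum_congr rfl fun a ha => h a (Finset.mem_filter.1 ha).2]
  simp

theorem card_filter_split (P Q : α → Prop) [DecidablePred P] [DecidablePred Q] :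
    (Finset.card {a | P a} : ℤ) =
      Finset.card {a | P a ∧ Q a} + Finset.card {a | P a ∧ ¬ Q a} := by
  rw [← Finset.filter_filter, ← Finset.filter_filter]
  exact_mod_cast (Finset.card_filter_add_card_filter_not (s := Finset.univ.filter P) Q).symm

/-- Inclusion and exclusion for three properties that never hold together. -/
theorem card_filter_none_of_three (P A B C : α → Prop) [DecidablePred P] [DecidablePred A]
    [DecidablePred B] [DecidablePred C] (h : ∀ a, P a → A a → B a → C a → False) :
    (Finset.card {a | P a ∧ ¬ A a ∧ ¬ B a ∧ ¬ C a} : ℤ) =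
      Finset.card {a | P a} - Finset.card {a | P a ∧ A a} - Finset.card {a | P a ∧ B a}
        - Finset.card {a | P a ∧ C a} + Finset.card {a | P a ∧ A a ∧ B a}
        + Finset.card {a | P a ∧ B a ∧ C a} + Finset.card {a | P a ∧ C a ∧ A a} := by
  simp only [Finset.card_filter, Nat.cast_sum, ← Finset.sum_sub_distrib, ← Finset.sum_add_distrib]
  refine Finset.sum_congr rfl fun a _ => ?_
  have := h a
  by_cases hP : P a <;> by_cases hA : A a <;> by_cases hB : B a <;> by_cases hC : C a <;>
    simp_all

end CardLemmas

/-! ### Local counts in a strongly regular graph with parameters `(n, k, 1, 2)`. -/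

section StronglyRegular

variable {V : Type*} [Fintype V] {G : SimpleGraph V} [DecidableRel G.Adj]
  {n k : ℕ}

theorem SimpleGraph.IsSRGWith.card_common (h : G.IsSRGWith n k 1 2) {u v : V} (hne : u ≠ v)
    (huv : ¬ G.Adj u v) : Finset.card {w | G.Adj u w ∧ G.Adj v w} = 2 := by
  rw [← h.of_not_adj hne huv, ← Set.toFinset_card]
  congr 1
  ext w
  simp [SimpleGraph.mem_commonNeighbors]

theorem SimpleGraph.IsSRGWith.card_common_of_adj (h : G.IsSRGWith n k 1 2) {u v : V}
    (huv : G.Adj u v) : Finset.card {w | G.Adj u w ∧ G.Adj v w} = 1 := by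
  rw [← h.of_adj u v huv, ← Set.toFinset_card]
  congr 1
  ext w
  simp [SimpleGraph.mem_commonNeighbors]

theorem SimpleGraph.IsSRGWith.card_adj (h : G.IsSRGWith n k 1 2) (u : V) :
    Finset.card {w | G.Adj u w} = k := by
  rw [← h.regular u, ← SimpleGraph.card_neighborFinset_eq_degree]
  congr 1
  ext w
  simp

theorem SimpleGraph.IsSRGWith.exists_third (h : G.IsSRGWith n k 1 2) {u v : V}
    (huv : G.Adj u v) : ∃ w, G.Adj u w ∧ G.Adj v w := by
  obtain ⟨w, hw⟩ := Finset.card_pos.1 (by rw [h.card_common_of_adj huv]; exact one_pos)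
  exact ⟨w, by simpa using hw⟩

theorem SimpleGraph.IsSRGWith.third_unique (h : G.IsSRGWith n k 1 2) {u v w w' : V}
    (huv : G.Adj u v) (h1 : G.Adj u w) (h2 : G.Adj v w) (h3 : G.Adj u w') (h4 : G.Adj v w') :
    w = w' :=
  Finset.card_le_one.1 (h.card_common_of_adj huv).le w (by simp [h1, h2]) w' (by simp [h3, h4])

theorem SimpleGraph.IsSRGWith.exists_other (h : G.IsSRGWith n k 1 2) {u v a : V} (hne : u ≠ v)
    (huv : ¬ G.Adj u v) : ∃ b, b ≠ a ∧ G.Adj u b ∧ G.Adj v b := by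
  obtain ⟨b, hb, hba⟩ := Finset.exists_mem_ne
    (by rw [h.card_common hne huv]; exact one_lt_two) a
  exact ⟨b, hba, by simpa using hb⟩

theorem SimpleGraph.IsSRGWith.card_adj_pairs (h : G.IsSRGWith n k 1 2) :
    (Finset.card {t : V × V | G.Adj t.1 t.2} : ℤ) = n * k := by
  have := card_filter_prod_of_const (fun _ : V => True) (fun p q => G.Adj p q) k
    fun a _ => by rw [h.card_adj]
  simpa [h.card] using this

variable [DecidableEq V]

/-- Distinct vertices have at most two common neighbours in either case, so callers need not know
whether `u` and `v` are adjacent. -/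
theorem SimpleGraph.IsSRGWith.other_unique (h : G.IsSRGWith n k 1 2) {u v a b c : V}
    (hne : u ≠ v) (hua : G.Adj u a) (hva : G.Adj v a) (hub : G.Adj u b) (hvb : G.Adj v b)
    (huc : G.Adj u c) (hvc : G.Adj v c) (hba : b ≠ a) (hca : c ≠ a) : b = c := by
  by_cases huv : G.Adj u v
  · exact h.third_unique huv hub hvb huc hvc
  · by_contra hbc
    have h3 : ({a, b, c} : Finset V) ⊆ ({w | G.Adj u w ∧ G.Adj v w} : Finset V) := by
      intro w
      simp only [Finset.mem_insert, Finset.mem_singleton, Finset.mem_filter, Finset.mem_univ,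
        true_and]
      rintro (rfl | rfl | rfl) <;> exact ⟨by assumption, by assumption⟩
    have := Finset.card_le_card h3
    rw [h.card_common hne huv, Finset.card_eq_three.2
      ⟨a, b, c, hba.symm, hca.symm, hbc, rfl⟩] at this
    omega

theorem SimpleGraph.IsSRGWith.card_adj_not_adj (h : G.IsSRGWith n k 1 2) {p q : V}
    (hpq : G.Adj p q) : (Finset.card {z | G.Adj q z ∧ z ≠ p ∧ ¬ G.Adj p z} : ℤ) = k - 2 := by
  obtain ⟨y, hy1, hy2⟩ := h.exists_third hpq
  have hs : ({z | G.Adj q z ∧ z ≠ p ∧ ¬ G.Adj p z} : Finset V) =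
      ({z | G.Adj q z} : Finset V) \ {p, y} := by
    ext z
    simp only [Finset.mem_filter, Finset.mem_univ, true_and, Finset.mem_sdiff, Finset.mem_insert,
      Finset.mem_singleton, not_or]
    refine and_congr_right fun hqz => and_congr_right fun _ => not_congr ⟨fun hpz => ?_, ?_⟩
    · exact h.third_unique hpq hpz hqz hy1 hy2
    · rintro rfl
      exact hy1
  have hsub : ({p, y} : Finset V) ⊆ ({z | G.Adj q z} : Finset V) := by
    intro w
    simp only [Finset.mem_insert, Finset.mem_singleton, Finset.mem_filter, Finset.mem_univ,
      true_and]
    rintro (rfl | rfl)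
    exacts [hpq.symm, hy2]
  rw [hs, Finset.cast_card_sdiff hsub, h.card_adj, Finset.card_pair hy1.ne]
  rfl

/-- The vertices `q` and `x` are non-adjacent neighbours of `p`. -/
def IsCherry (G : SimpleGraph V) (p q x : V) : Prop :=
  G.Adj p q ∧ G.Adj p x ∧ x ≠ q ∧ ¬ G.Adj q x

instance (p q x : V) : Decidable (IsCherry G p q x) := inferInstanceAs (Decidable (_ ∧ _))

theorem SimpleGraph.IsSRGWith.card_cherry (h : G.IsSRGWith n k 1 2) :
    (Finset.card {t : V × V × V | IsCherry G t.1 t.2.1 t.2.2} : ℤ) = n * k * (k - 2) := by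
  rw [← h.card_adj_pairs, ← card_filter_prod_of_const (fun t : V × V => G.Adj t.1 t.2)
    (fun t z => G.Adj t.1 z ∧ z ≠ t.2 ∧ ¬ G.Adj t.2 z) (k - 2 : ℤ)
    fun t ht => h.card_adj_not_adj ht.symm]
  congr 1
  exact Finset.card_equiv (Equiv.prodAssoc V V V).symm fun t => by
    rw [Finset.mem_filter, Finset.mem_filter]
    simp only [Finset.mem_univ, true_and, IsCherry, Equiv.prodAssoc_symm_apply]

/-- Of the `k - 2` neighbours of `q` outside its triangle with `p`, exactly one is adjacent to `x`:
the common neighbour of `q` and `x` other than `p`. -/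
theorem SimpleGraph.IsSRGWith.card_adj_not_adj_cherry (h : G.IsSRGWith n k 1 2) {p q x : V}
    (hc : IsCherry G p q x) :
    (Finset.card {z | (G.Adj q z ∧ z ≠ p ∧ ¬ G.Adj p z) ∧ ¬ G.Adj x z} : ℤ) = k - 3 := by
  obtain ⟨hpq, hpx, hxq, hqx⟩ := hc
  have hsplit := card_filter_split (fun z => G.Adj q z ∧ z ≠ p ∧ ¬ G.Adj p z) (fun z => G.Adj x z)
  rw [h.card_adj_not_adj hpq] at hsplit
  obtain ⟨z, hzp, hqz, hxz⟩ := h.exists_other (a := p) hxq.symm hqx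
  have hone : Finset.card {z | (G.Adj q z ∧ z ≠ p ∧ ¬ G.Adj p z) ∧ G.Adj x z} = 1 := by
    rw [Finset.card_eq_one]
    refine ⟨z, ?_⟩
    ext w
    simp only [Finset.mem_filter, Finset.mem_univ, true_and, Finset.mem_singleton]
    constructor
    · rintro ⟨⟨hqw, hwp, -⟩, hxw⟩
      exact h.other_unique hxq.symm hpq.symm hpx.symm hqw hxw hqz hxz hwp hzp
    · rintro rfl
      exact ⟨⟨hqz, hzp, fun hpw =>
        hxq (h.third_unique hpw hpx hxz.symm hpq hqz.symm)⟩, hxz⟩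
  rw [hone] at hsplit
  push_cast at hsplit
  linarith

/-- The triangles on `wx` and `wy` share only `w`, so they exclude four neighbours of `w`. -/
theorem SimpleGraph.IsSRGWith.card_adj_not_adj_not_adj (h : G.IsSRGWith n k 1 2) {w x y : V}
    (hc : IsCherry G w x y) :
    (Finset.card {z | G.Adj w z ∧ z ≠ x ∧ z ≠ y ∧ ¬ G.Adj x z ∧ ¬ G.Adj y z} : ℤ) = k - 4 := by
  obtain ⟨hwx, hwy, hyx, hxy⟩ := hc
  have hsplit := card_filter_split (fun z => G.Adj w z ∧ z ≠ x ∧ ¬ G.Adj x z)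
    (fun z => z = y ∨ G.Adj y z)
  rw [h.card_adj_not_adj hwx.symm] at hsplit
  obtain ⟨y', hy1, hy2⟩ := h.exists_third hwy
  have htwo : Finset.card {z | (G.Adj w z ∧ z ≠ x ∧ ¬ G.Adj x z) ∧ (z = y ∨ G.Adj y z)} = 2 := by
    rw [Finset.card_eq_two]
    refine ⟨y, y', hy2.ne, ?_⟩
    ext z
    simp only [Finset.mem_filter, Finset.mem_univ, true_and, Finset.mem_singleton,
      Finset.mem_insert]
    constructor
    · rintro ⟨⟨hwz, -, -⟩, rfl | hyz⟩
      · exact Or.inl rfl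
      · exact Or.inr (h.third_unique hwy hwz hyz hy1 hy2)
    · rintro (rfl | rfl)
      · exact ⟨⟨hwy, hyx, hxy⟩, Or.inl rfl⟩
      · refine ⟨⟨hy1, ?_, fun hxz => hyx ?_⟩, Or.inr hy2⟩
        · rintro rfl
          exact hxy hy2.symm
        · exact h.third_unique hy1 hwy hy2.symm hwx hxz.symm
  rw [htwo] at hsplit
  push_cast at hsplit
  have hs : ({z | G.Adj w z ∧ z ≠ x ∧ z ≠ y ∧ ¬ G.Adj x z ∧ ¬ G.Adj y z} : Finset V) =
      ({z | (G.Adj w z ∧ z ≠ x ∧ ¬ G.Adj x z) ∧ ¬ (z = y ∨ G.Adj y z)} : Finset V) := by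
    ext z
    simp only [Finset.mem_filter, Finset.mem_univ, true_and]
    tauto
  rw [hs]
  linarith

theorem SimpleGraph.IsSRGWith.card_not_adj (h : G.IsSRGWith n k 1 2) (x : V) :
    (Finset.card {y | x ≠ y ∧ ¬ G.Adj x y} : ℤ) = n - k - 1 := by
  have h1 := card_filter_split (fun _ : V => True) (fun y => G.Adj x y)
  have h2 := card_filter_split (fun y : V => ¬ G.Adj x y) (fun y => y = x)
  have h3 : ({y | ¬ G.Adj x y ∧ y = x} : Finset V) = {x} := by
    ext y
    simp only [Finset.mem_filter, Finset.mem_univ, true_and, Finset.mem_singleton]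
    exact ⟨fun hy => hy.2, by rintro rfl; simp⟩
  have h4 : ({y | x ≠ y ∧ ¬ G.Adj x y} : Finset V) =
      ({y | ¬ G.Adj x y ∧ ¬ y = x} : Finset V) := by
    ext y
    simp [and_comm, eq_comm]
  rw [h3] at h2
  simp only [true_and, h.card_adj, Finset.filter_true, Finset.card_univ, h.card] at h1
  rw [h4]
  push_cast [Finset.card_singleton] at *
  linarith

theorem SimpleGraph.IsSRGWith.card_not_adj_not_adj (h : G.IsSRGWith n k 1 2) {x y : V}
    (hne : x ≠ y) (hxy : ¬ G.Adj x y) :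
    (Finset.card {z | (x ≠ z ∧ ¬ G.Adj x z) ∧ (y ≠ z ∧ ¬ G.Adj y z)} : ℤ) = n - 2 * k := by
  have h1 := card_filter_split (fun z => x ≠ z ∧ ¬ G.Adj x z) (fun z => y ≠ z ∧ ¬ G.Adj y z)
  have h2 := card_filter_split (fun z => G.Adj y z) (fun z => G.Adj x z)
  have h3 : ({z | (x ≠ z ∧ ¬ G.Adj x z) ∧ ¬ (y ≠ z ∧ ¬ G.Adj y z)} : Finset V) =
      insert y ({z | G.Adj y z ∧ ¬ G.Adj x z} : Finset V) := by
    ext z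
    simp only [Finset.mem_filter, Finset.mem_univ, true_and, Finset.mem_insert]
    constructor
    · intro hz
      by_cases hzy : z = y
      · exact Or.inl hzy
      · exact Or.inr ⟨by tauto, hz.1.2⟩
    · rintro (rfl | hz)
      · simp [hne, hxy]
      · refine ⟨⟨?_, hz.2⟩, fun h => h.2 hz.1⟩
        rintro rfl
        exact hxy hz.1.symm
  have h4 : ({z | G.Adj y z ∧ G.Adj x z} : Finset V) =
      ({z | G.Adj x z ∧ G.Adj y z} : Finset V) := by
    ext z
    simp [and_comm]
  rw [h.card_not_adj, h3, Finset.card_insert_of_notMem (by simp)] at h1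
  rw [h.card_adj, h4, h.card_common hne hxy] at h2
  push_cast at *
  linarith

theorem SimpleGraph.IsSRGWith.two_mul_card_not_adj (h : G.IsSRGWith n k 1 2) (hn : 0 < n) :
    2 * ((n : ℤ) - k - 1) = k * (k - 2) := by
  have hp := SimpleGraph.IsSRGWith.param_eq G h hn
  have hkn : k < n := by
    obtain ⟨v⟩ : Nonempty V := Fintype.card_pos_iff.1 (h.card ▸ hn)
    rw [← h.regular v, ← h.card]
    exact G.degree_lt_card_verts v
  have h1 : ((n - k - 1 : ℕ) : ℤ) = n - k - 1 := by omega
  -- The truncated `k - 1 - 1` of `param_eq` is harmless unless `k = 1`, where `card_adj_not_adj`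
  -- would give a set of size -1.
  have hk : k = 0 ∨ 2 ≤ k := by
    by_contra! hk
    have : k = 1 := by omega
    subst this
    obtain ⟨v⟩ : Nonempty V := Fintype.card_pos_iff.1 (h.card ▸ hn)
    obtain ⟨w, hw⟩ := Finset.card_pos.1 (by rw [h.card_adj v]; exact one_pos)
    have := h.card_adj_not_adj (p := w) (q := v) (by simpa using hw : G.Adj v w).symm
    push_cast at this
  have h2 : (k : ℤ) * ((k - 1 - 1 : ℕ) : ℤ) = k * (k - 2) := by
    rcases hk with rfl | hk
    · simp
    · congr 1
      omega
  rw [← h1, ← h2]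
  exact_mod_cast (by rw [hp, mul_comm])

end StronglyRegular

/-! ### Hexagon frames and their chords. -/

section HexagonCount

variable {V : Type*} [Fintype V] [DecidableEq V] {G : SimpleGraph V} [DecidableRel G.Adj]
  {n k : ℕ}

/-- The vertices `x`, `y`, `z` are distinct and pairwise non-adjacent. -/
def IsIndepTriple (G : SimpleGraph V) (x y z : V) : Prop :=
  (x ≠ y ∧ ¬ G.Adj x y) ∧ (x ≠ z ∧ ¬ G.Adj x z) ∧ (y ≠ z ∧ ¬ G.Adj y z)

instance (x y z : V) : Decidable (IsIndepTriple G x y z) := inferInstanceAs (Decidable (_ ∧ _))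

/-- The closed walk `x p y q z r` is a 6-cycle in which `x`, `y`, `z` are independent and no two
opposite vertices are adjacent; the vertices `p`, `q`, `r` may be adjacent. -/
def IsHexFrame (G : SimpleGraph V) (x y z p q r : V) : Prop :=
  IsIndepTriple G x y z ∧ (G.Adj x p ∧ G.Adj y p ∧ ¬ G.Adj z p) ∧
    (G.Adj y q ∧ G.Adj z q ∧ ¬ G.Adj x q) ∧ (G.Adj z r ∧ G.Adj x r ∧ ¬ G.Adj y r)

instance (x y z p q r : V) : Decidable (IsHexFrame G x y z p q r) :=
  inferInstanceAs (Decidable (_ ∧ _))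

/-- A triangle `p q y` with a path `p x r z q` joining two of its vertices. -/
def IsLinkedTriangle (G : SimpleGraph V) (p q y x z r : V) : Prop :=
  (G.Adj p q ∧ G.Adj q y ∧ G.Adj p y) ∧ (G.Adj p x ∧ x ≠ q ∧ x ≠ y) ∧
    (G.Adj q z ∧ z ≠ p ∧ z ≠ y) ∧ G.Adj x r ∧ G.Adj z r

instance (p q y x z r : V) : Decidable (IsLinkedTriangle G p q y x z r) :=
  inferInstanceAs (Decidable (_ ∧ _))

theorem SimpleGraph.IsSRGWith.card_indepTriple (h : G.IsSRGWith n k 1 2) :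
    (Finset.card {t : V × V × V | IsIndepTriple G t.1 t.2.1 t.2.2} : ℤ) =
      n * (n - k - 1) * (n - 2 * k) := by
  have h1 : (Finset.card {t : V × V | t.1 ≠ t.2 ∧ ¬ G.Adj t.1 t.2} : ℤ) = n * (n - k - 1) := by
    have := card_filter_prod_of_const (fun _ : V => True) (fun x y => x ≠ y ∧ ¬ G.Adj x y)
      (n - k - 1 : ℤ) fun a _ => h.card_not_adj a
    simpa only [true_and, Finset.filter_true, Finset.card_univ, h.card] using this
  rw [← h1, ← card_filter_prod_of_const (fun t : V × V => t.1 ≠ t.2 ∧ ¬ G.Adj t.1 t.2)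
    (fun t z => (t.1 ≠ z ∧ ¬ G.Adj t.1 z) ∧ (t.2 ≠ z ∧ ¬ G.Adj t.2 z)) (n - 2 * k : ℤ)
    fun t ht => h.card_not_adj_not_adj ht.1 ht.2]
  congr 1
  refine Finset.card_equiv (Equiv.prodAssoc V V V).symm fun t => ?_
  rw [Finset.mem_filter, Finset.mem_filter]
  simp only [Finset.mem_univ, true_and, IsIndepTriple, Equiv.prodAssoc_symm_apply]

/-- Double counting: choose the common neighbour `w` first, then three pairwise non-adjacent
neighbours of it. -/
theorem SimpleGraph.IsSRGWith.sum_card_common_indepTriple (h : G.IsSRGWith n k 1 2) :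
    ((∑ t : V × V × V with IsIndepTriple G t.1 t.2.1 t.2.2,
      Finset.card {w | G.Adj t.1 w ∧ G.Adj t.2.1 w ∧ G.Adj t.2.2 w} : ℕ) : ℤ) =
      n * k * (k - 2) * (k - 4) := by
  rw [← h.card_cherry, ← card_filter_prod_of_const
    (fun t : V × V × V => IsCherry G t.1 t.2.1 t.2.2)
    (fun t z => G.Adj t.1 z ∧ z ≠ t.2.1 ∧ z ≠ t.2.2 ∧ ¬ G.Adj t.2.1 z ∧ ¬ G.Adj t.2.2 z)
    (k - 4 : ℤ) fun t ht => h.card_adj_not_adj_not_adj ht,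
    ← card_filter_prod_eq_sum (fun t : V × V × V => IsIndepTriple G t.1 t.2.1 t.2.2)
    (fun t w => G.Adj t.1 w ∧ G.Adj t.2.1 w ∧ G.Adj t.2.2 w)]
  congr 1
  refine Finset.card_bij' (fun t _ => ((t.2, t.1.1, t.1.2.1), t.1.2.2))
    (fun t _ => ((t.1.2.1, t.1.2.2, t.2), t.1.1)) ?_ ?_ (fun _ _ => rfl) (fun _ _ => rfl)
  · rintro ⟨⟨x, y, z⟩, w⟩ ht
    rw [Finset.mem_filter] at ht ⊢
    simp only [Finset.mem_univ, true_and, IsIndepTriple, IsCherry, G.adj_comm w] at ht ⊢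
    grind
  · rintro ⟨⟨w, x, y⟩, z⟩ ht
    rw [Finset.mem_filter] at ht ⊢
    simp only [Finset.mem_univ, true_and, IsIndepTriple, IsCherry, G.adj_comm w] at ht ⊢
    grind

/-- The number of hexagon frames on a given independent triple. -/
theorem SimpleGraph.IsSRGWith.card_frames_of_triple (h : G.IsSRGWith n k 1 2) {x y z : V}
    (ht : IsIndepTriple G x y z) :
    (Finset.card {s : V × V × V | (G.Adj x s.1 ∧ G.Adj y s.1 ∧ ¬ G.Adj z s.1) ∧
      (G.Adj y s.2.1 ∧ G.Adj z s.2.1 ∧ ¬ G.Adj x s.2.1) ∧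
      (G.Adj z s.2.2 ∧ G.Adj x s.2.2 ∧ ¬ G.Adj y s.2.2)} : ℤ) =
      8 - 7 * Finset.card {w | G.Adj x w ∧ G.Adj y w ∧ G.Adj z w} := by
  obtain ⟨hxy, hxz, hyz⟩ := ht
  set c := Finset.card {w | G.Adj x w ∧ G.Adj y w ∧ G.Adj z w} with hc
  -- Two common neighbours of the triple would themselves share the three vertices `x`, `y`, `z`.
  have hle : c ≤ 1 := by
    rw [hc, Finset.card_le_one]
    intro a ha b hb
    simp only [Finset.mem_filter, Finset.mem_univ, true_and] at ha hb
    by_contra hab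
    exact hyz.1 (h.other_unique hab ha.1.symm hb.1.symm ha.2.1.symm hb.2.1.symm
      ha.2.2.symm hb.2.2.symm hxy.1.symm hxz.1.symm)
  have aux : ∀ u v w : V, u ≠ v → ¬ G.Adj u v →
      Finset.card {a | G.Adj u a ∧ G.Adj v a ∧ G.Adj w a} = c →
      (Finset.card {a | G.Adj u a ∧ G.Adj v a ∧ ¬ G.Adj w a} : ℤ) = 2 - c := by
    intro u v w hne huv huvw
    have := card_filter_split (fun a => G.Adj u a ∧ G.Adj v a) (fun a => G.Adj w a)
    simp only [and_assoc] at this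
    rw [h.card_common hne huv, huvw] at this
    push_cast at this
    linarith
  have hp := aux x y z hxy.1 hxy.2 rfl
  have hq := aux y z x hyz.1 hyz.2 (by rw [hc]; congr 1; ext; simp; tauto)
  have hr := aux z x y hxz.1.symm (fun h => hxz.2 h.symm) (by rw [hc]; congr 1; ext; simp; tauto)
  have hprod : ({s : V × V × V | (G.Adj x s.1 ∧ G.Adj y s.1 ∧ ¬ G.Adj z s.1) ∧
      (G.Adj y s.2.1 ∧ G.Adj z s.2.1 ∧ ¬ G.Adj x s.2.1) ∧
      (G.Adj z s.2.2 ∧ G.Adj x s.2.2 ∧ ¬ G.Adj y s.2.2)} : Finset (V × V × V)) =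
      ({a | G.Adj x a ∧ G.Adj y a ∧ ¬ G.Adj z a} : Finset V) ×ˢ
      (({a | G.Adj y a ∧ G.Adj z a ∧ ¬ G.Adj x a} : Finset V) ×ˢ
      ({a | G.Adj z a ∧ G.Adj x a ∧ ¬ G.Adj y a} : Finset V)) := by
    ext s
    simp only [Finset.mem_filter, Finset.mem_univ, true_and, Finset.mem_product]
  rw [hprod, Finset.card_product, Finset.card_product]
  push_cast
  rw [hp, hq, hr]
  interval_cases c <;> norm_num

theorem SimpleGraph.IsSRGWith.card_hexFrame (h : G.IsSRGWith n k 1 2) :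
    (Finset.card {t : (V × V × V) × (V × V × V) |
      IsHexFrame G t.1.1 t.1.2.1 t.1.2.2 t.2.1 t.2.2.1 t.2.2.2} : ℤ) =
      8 * (n * (n - k - 1) * (n - 2 * k)) - 7 * (n * k * (k - 2) * (k - 4)) := by
  have := card_filter_prod_eq_sum (fun t : V × V × V => IsIndepTriple G t.1 t.2.1 t.2.2)
    (fun t s : V × V × V => (G.Adj t.1 s.1 ∧ G.Adj t.2.1 s.1 ∧ ¬ G.Adj t.2.2 s.1) ∧
      (G.Adj t.2.1 s.2.1 ∧ G.Adj t.2.2 s.2.1 ∧ ¬ G.Adj t.1 s.2.1) ∧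
      (G.Adj t.2.2 s.2.2 ∧ G.Adj t.1 s.2.2 ∧ ¬ G.Adj t.2.1 s.2.2))
  refine (congrArg Nat.cast this).trans ?_
  rw [Nat.cast_sum, Finset.sum_congr rfl fun t ht =>
    h.card_frames_of_triple (Finset.mem_filter.1 ht).2, Finset.sum_sub_distrib,
    ← Finset.mul_sum, ← h.sum_card_common_indepTriple, ← h.card_indepTriple]
  simp [mul_comm]

/-- The path `p y r` determines everything: `q` completes the triangle on `py`, while `x` and `z`
are the common neighbours other than `y` of `p, r` and of `q, r`. -/
theorem SimpleGraph.IsSRGWith.card_linkedTriangle_tip_adj (h : G.IsSRGWith n k 1 2) :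
    (Finset.card {t : (V × V × V) × (V × V × V) |
      IsLinkedTriangle G t.1.1 t.1.2.1 t.1.2.2 t.2.1 t.2.2.1 t.2.2.2 ∧
        G.Adj t.1.2.2 t.2.2.2} : ℤ) = n * k * (k - 2) := by
  rw [← h.card_cherry]
  congr 1
  have hT := @SimpleGraph.IsSRGWith.third_unique V _ G _ n k h
  have hO := @SimpleGraph.IsSRGWith.other_unique V _ G _ n k _ h
  refine Finset.card_bij (fun t _ => (t.1.2.2, t.1.1, t.2.2.2)) ?_ ?_ ?_
  · rintro ⟨⟨p, q, y⟩, x, z, r⟩ ht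
    rw [Finset.mem_filter] at ht ⊢
    simp only [Finset.mem_univ, true_and, IsLinkedTriangle, IsCherry] at ht ⊢
    obtain ⟨⟨⟨hpq, hqy, hpy⟩, ⟨hpx, hxq, hxy⟩, ⟨hqz, hzp, hzy⟩, hxr, hzr⟩, hyr⟩ := ht
    refine ⟨hpy.symm, hyr, ?_, fun hpr => ?_⟩
    · rintro rfl
      exact hzy (hT hpq hzr.symm hqz hpy hqy)
    · obtain rfl := hT hpy hpr hyr hpq hqy.symm
      exact hxy (hT hpq hpx hxr.symm hpy hqy)
  · rintro ⟨⟨p, q, y⟩, x, z, r⟩ ht ⟨⟨p', q', y'⟩, x', z', r'⟩ ht' heq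
    rw [Finset.mem_filter] at ht ht'
    simp only [Finset.mem_univ, true_and, IsLinkedTriangle, Prod.mk.injEq] at ht ht' heq
    obtain ⟨rfl, rfl, rfl⟩ := heq
    obtain ⟨⟨⟨hpq, hqy, hpy⟩, ⟨hpx, hxq, hxy⟩, ⟨hqz, hzp, hzy⟩, hxr, hzr⟩, hyr⟩ := ht
    obtain ⟨⟨⟨hpq', hqy', -⟩, ⟨hpx', hxq', hxy'⟩, ⟨hqz', hzp', hzy'⟩, hxr', hzr'⟩, -⟩ := ht'
    obtain rfl := hT hpy hpq hqy.symm hpq' hqy'.symm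
    have hpr : p ≠ r := by
      rintro rfl
      exact hzy (hT hpq hzr.symm hqz hpy hqy)
    have hqr : q ≠ r := by
      rintro rfl
      exact hxy (hT hpq hpx hxr.symm hpy hqy)
    obtain rfl := hO hpr hpy hyr.symm hpx hxr.symm hpx' hxr'.symm hxy hxy'
    obtain rfl := hO hqr hqy hyr.symm hqz hzr.symm hqz' hzr'.symm hzy hzy'
    rfl
  · rintro ⟨y, p, r⟩ ht
    rw [Finset.mem_filter] at ht
    obtain ⟨-, hyp, hyr, hrp, hpr⟩ := ht
    dsimp only at hyp hyr hrp hpr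
    obtain ⟨q, hyq, hpq⟩ := h.exists_third hyp
    have hqr : ¬ G.Adj q r := fun hqr => hrp (hT hyq hyr hqr hyp hpq.symm)
    have hqr' : q ≠ r := by
      rintro rfl
      exact hpr hpq
    obtain ⟨x, hxy, hpx, hrx⟩ := h.exists_other (a := y) hrp.symm hpr
    obtain ⟨z, hzy, hqz, hrz⟩ := h.exists_other (a := y) hqr' hqr
    refine ⟨((p, q, y), x, z, r), ?_, rfl⟩
    rw [Finset.mem_filter]
    dsimp only
    refine ⟨Finset.mem_univ _, ⟨⟨hpq, hyq.symm, hyp.symm⟩, ⟨hpx, ?_, hxy⟩, ⟨hqz, ?_, hzy⟩,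
      hrx.symm, hrz.symm⟩, hyr⟩
    · rintro rfl
      exact hqr hrx.symm
    · rintro rfl
      exact hpr hrz.symm

/-- The path `q p x` determines everything: `y` completes the triangle on `pq`, `z` is the common
neighbour of `q, x` other than `p`, and `r` completes the triangle on `xz`. -/
theorem SimpleGraph.IsSRGWith.card_linkedTriangle_adj (h : G.IsSRGWith n k 1 2) :
    (Finset.card {t : (V × V × V) × (V × V × V) |
      IsLinkedTriangle G t.1.1 t.1.2.1 t.1.2.2 t.2.1 t.2.2.1 t.2.2.2 ∧
        G.Adj t.2.1 t.2.2.1} : ℤ) = n * k * (k - 2) := by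
  rw [← h.card_cherry]
  congr 1
  have hT := @SimpleGraph.IsSRGWith.third_unique V _ G _ n k h
  have hO := @SimpleGraph.IsSRGWith.other_unique V _ G _ n k _ h
  refine Finset.card_bij (fun t _ => (t.1.1, t.1.2.1, t.2.1)) ?_ ?_ ?_
  · rintro ⟨⟨p, q, y⟩, x, z, r⟩ ht
    rw [Finset.mem_filter] at ht ⊢
    simp only [Finset.mem_univ, true_and, IsLinkedTriangle, IsCherry] at ht ⊢
    obtain ⟨⟨⟨hpq, hqy, hpy⟩, ⟨hpx, hxq, hxy⟩, ⟨hqz, hzp, hzy⟩, hxr, hzr⟩, hxz⟩ := ht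
    exact ⟨hpq, hpx, hxq, fun hqx => hxy (hT hpq hpx hqx hpy hqy)⟩
  · rintro ⟨⟨p, q, y⟩, x, z, r⟩ ht ⟨⟨p', q', y'⟩, x', z', r'⟩ ht' heq
    rw [Finset.mem_filter] at ht ht'
    simp only [Finset.mem_univ, true_and, IsLinkedTriangle, Prod.mk.injEq] at ht ht' heq
    obtain ⟨rfl, rfl, rfl⟩ := heq
    obtain ⟨⟨⟨hpq, hqy, hpy⟩, ⟨hpx, hxq, hxy⟩, ⟨hqz, hzp, hzy⟩, hxr, hzr⟩, hxz⟩ := ht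
    obtain ⟨⟨⟨-, hqy', hpy'⟩, -, ⟨hqz', hzp', hzy'⟩, hxr', hzr'⟩, hxz'⟩ := ht'
    obtain rfl := hT hpq hpy hqy hpy' hqy'
    obtain rfl := hO hxq hpx.symm hpq.symm hxz hqz hxz' hqz' hzp hzp'
    obtain rfl := hT hxz hxr hzr hxr' hzr'
    rfl
  · rintro ⟨p, q, x⟩ ht
    rw [Finset.mem_filter] at ht
    obtain ⟨-, hpq, hpx, hxq, hqx⟩ := ht
    dsimp only at hpq hpx hxq hqx
    obtain ⟨y, hpy, hqy⟩ := h.exists_third hpq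
    obtain ⟨z, hzp, hqz, hxz⟩ := h.exists_other (a := p) hxq.symm hqx
    obtain ⟨r, hxr, hzr⟩ := h.exists_third hxz
    refine ⟨((p, q, y), x, z, r), ?_, rfl⟩
    rw [Finset.mem_filter]
    dsimp only
    refine ⟨Finset.mem_univ _, ⟨⟨hpq, hqy, hpy⟩, ⟨hpx, hxq, ?_⟩, ⟨hqz, hzp, ?_⟩, hxr, hzr⟩, hxz⟩
    · rintro rfl
      exact hqx hqy
    · rintro rfl
      exact hxq (hT hpy hpx hxz.symm hpq hqy.symm)

/-- Given the path `q p x`, there are `k - 3` choices of `z`, and then `r` is either of the two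
common neighbours of `x` and `z`. -/
theorem SimpleGraph.IsSRGWith.card_linkedTriangle_not_adj (h : G.IsSRGWith n k 1 2) :
    (Finset.card {t : (V × V × V) × (V × V × V) |
      IsLinkedTriangle G t.1.1 t.1.2.1 t.1.2.2 t.2.1 t.2.2.1 t.2.2.2 ∧
        ¬ G.Adj t.2.1 t.2.2.1} : ℤ) = n * k * (k - 2) * (k - 3) * 2 := by
  have hT := @SimpleGraph.IsSRGWith.third_unique V _ G _ n k h
  rw [← h.card_cherry, ← card_filter_prod_of_const
    (fun t : V × V × V => IsCherry G t.1 t.2.1 t.2.2)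
    (fun t z => (G.Adj t.2.1 z ∧ z ≠ t.1 ∧ ¬ G.Adj t.1 z) ∧ ¬ G.Adj t.2.2 z)
    (k - 3 : ℤ) fun t ht => h.card_adj_not_adj_cherry ht,
    ← card_filter_prod_of_const
    (fun t : (V × V × V) × V => IsCherry G t.1.1 t.1.2.1 t.1.2.2 ∧
      (G.Adj t.1.2.1 t.2 ∧ t.2 ≠ t.1.1 ∧ ¬ G.Adj t.1.1 t.2) ∧ ¬ G.Adj t.1.2.2 t.2)
    (fun t r => G.Adj t.1.2.2 r ∧ G.Adj t.2 r)
    (2 : ℤ) fun t ht => by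
      rw [h.card_common _ ht.2.2]
      · rfl
      · intro heq
        exact ht.1.2.2.2 (heq ▸ ht.2.1.1)]
  congr 1
  refine Finset.card_bij (fun t _ => (((t.1.1, t.1.2.1, t.2.1), t.2.2.1), t.2.2.2)) ?_ ?_ ?_
  · rintro ⟨⟨p, q, y⟩, x, z, r⟩ ht
    rw [Finset.mem_filter] at ht ⊢
    simp only [Finset.mem_univ, true_and, IsLinkedTriangle, IsCherry] at ht ⊢
    obtain ⟨⟨⟨hpq, hqy, hpy⟩, ⟨hpx, hxq, hxy⟩, ⟨hqz, hzp, hzy⟩, hxr, hzr⟩, hxz⟩ := ht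
    exact ⟨⟨⟨hpq, hpx, hxq, fun hqx => hxy (hT hpq hpx hqx hpy hqy)⟩,
      ⟨hqz, hzp, fun hpz => hzy (hT hpq hpz hqz hpy hqy)⟩, hxz⟩, hxr, hzr⟩
  · rintro ⟨⟨p, q, y⟩, x, z, r⟩ ht ⟨⟨p', q', y'⟩, x', z', r'⟩ ht' heq
    rw [Finset.mem_filter] at ht ht'
    simp only [Finset.mem_univ, true_and, IsLinkedTriangle, Prod.mk.injEq] at ht ht' heq
    obtain ⟨⟨⟨rfl, rfl, rfl⟩, rfl⟩, rfl⟩ := heq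
    obtain rfl := hT ht.1.1.1 ht.1.1.2.2 ht.1.1.2.1 ht'.1.1.2.2 ht'.1.1.2.1
    rfl
  · rintro ⟨⟨⟨p, q, x⟩, z⟩, r⟩ ht
    rw [Finset.mem_filter] at ht
    obtain ⟨-, ⟨⟨hpq, hpx, hxq, hqx⟩, ⟨hqz, hzp, hpz⟩, hxz⟩, hxr, hzr⟩ := ht
    dsimp only at *
    obtain ⟨y, hpy, hqy⟩ := h.exists_third hpq
    refine ⟨((p, q, y), x, z, r), ?_, rfl⟩
    rw [Finset.mem_filter]
    dsimp only
    refine ⟨Finset.mem_univ _, ⟨⟨hpq, hqy, hpy⟩, ⟨hpx, hxq, ?_⟩, ⟨hqz, hzp, ?_⟩, hxr, hzr⟩, hxz⟩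
    · rintro rfl
      exact hqx hqy
    · rintro rfl
      exact hpz hpy

/-- Hexagon frames with the chord `p q`, counted by doubly linked triangles. -/
theorem SimpleGraph.IsSRGWith.card_hexFrame_chord (h : G.IsSRGWith n k 1 2) :
    (Finset.card {t : (V × V × V) × (V × V × V) |
      IsHexFrame G t.1.1 t.1.2.1 t.1.2.2 t.2.1 t.2.2.1 t.2.2.2 ∧ G.Adj t.2.1 t.2.2.1} : ℤ) =
      n * k * (k - 2) * (k - 3) * 2 - Finset.card {t : (V × V × V) × (V × V × V) |
      (IsLinkedTriangle G t.1.1 t.1.2.1 t.1.2.2 t.2.1 t.2.2.1 t.2.2.2 ∧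
        G.Adj t.2.1 t.2.2.1) ∧ ¬ G.Adj t.1.2.2 t.2.2.2} := by
  have hT := @SimpleGraph.IsSRGWith.third_unique V _ G _ n k h
  -- Three splits by the edges `yr` and `xz`: the first two classes have equal size and share the
  -- case of both edges, so "only `yr`" and "only `xz`" have equal counts.
  have h1 := card_filter_split (fun t : (V × V × V) × (V × V × V) =>
    IsLinkedTriangle G t.1.1 t.1.2.1 t.1.2.2 t.2.1 t.2.2.1 t.2.2.2 ∧ G.Adj t.1.2.2 t.2.2.2)
    (fun t => G.Adj t.2.1 t.2.2.1)
  have h2 := card_filter_split (fun t : (V × V × V) × (V × V × V) =>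
    IsLinkedTriangle G t.1.1 t.1.2.1 t.1.2.2 t.2.1 t.2.2.1 t.2.2.2 ∧ G.Adj t.2.1 t.2.2.1)
    (fun t => G.Adj t.1.2.2 t.2.2.2)
  have h3 := card_filter_split (fun t : (V × V × V) × (V × V × V) =>
    IsLinkedTriangle G t.1.1 t.1.2.1 t.1.2.2 t.2.1 t.2.2.1 t.2.2.2 ∧ ¬ G.Adj t.2.1 t.2.2.1)
    (fun t => G.Adj t.1.2.2 t.2.2.2)
  rw [h.card_linkedTriangle_tip_adj] at h1
  rw [h.card_linkedTriangle_adj] at h2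
  rw [h.card_linkedTriangle_not_adj] at h3
  have h4 : Finset.card {t : (V × V × V) × (V × V × V) |
      IsHexFrame G t.1.1 t.1.2.1 t.1.2.2 t.2.1 t.2.2.1 t.2.2.2 ∧ G.Adj t.2.1 t.2.2.1} =
      Finset.card {t : (V × V × V) × (V × V × V) |
      (IsLinkedTriangle G t.1.1 t.1.2.1 t.1.2.2 t.2.1 t.2.2.1 t.2.2.2 ∧
        ¬ G.Adj t.2.1 t.2.2.1) ∧ ¬ G.Adj t.1.2.2 t.2.2.2} := by
    refine Finset.card_bij' (fun t _ => ((t.2.1, t.2.2.1, t.1.2.1), t.1.1, t.1.2.2, t.2.2.2))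
      (fun t _ => ((t.2.1, t.1.2.2, t.2.2.1), t.1.1, t.1.2.1, t.2.2.2)) ?_ ?_
      (fun _ _ => rfl) (fun _ _ => rfl)
    · rintro ⟨⟨x, y, z⟩, p, q, r⟩ ht
      rw [Finset.mem_filter] at ht ⊢
      simp only [Finset.mem_univ, true_and, IsLinkedTriangle, IsHexFrame, IsIndepTriple] at ht ⊢
      obtain ⟨⟨⟨hxy, hxz, hyz⟩, ⟨hxp, hyp, hzp⟩, ⟨hyq, hzq, hxq⟩, hzr, hxr, hyr⟩, hpq⟩ := ht
      refine ⟨⟨⟨⟨hpq, hyq.symm, hyp.symm⟩, ⟨hxp.symm, ?_, hxy.1⟩, ⟨hzq.symm, ?_, hyz.1.symm⟩,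
        hxr, hzr⟩, hxz.2⟩, hyr⟩
      · rintro rfl
        exact hxy.2 hyq.symm
      · rintro rfl
        exact hyz.2 hyp
    · rintro ⟨⟨p, q, y⟩, x, z, r⟩ ht
      rw [Finset.mem_filter] at ht ⊢
      simp only [Finset.mem_univ, true_and, IsLinkedTriangle, IsHexFrame, IsIndepTriple] at ht ⊢
      obtain ⟨⟨⟨⟨hpq, hqy, hpy⟩, ⟨hpx, hxq, hxy⟩, ⟨hqz, hzp, hzy⟩, hxr, hzr⟩, hxz⟩, hyr⟩ := ht
      refine ⟨⟨⟨⟨hxy, fun hadj => ?_⟩, ⟨?_, hxz⟩, ⟨hzy.symm, fun hadj => ?_⟩⟩,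
        ⟨hpx.symm, hpy.symm, fun hadj => ?_⟩, ⟨hqy.symm, hqz.symm, fun hadj => ?_⟩,
        hzr, hxr, hyr⟩, hpq⟩
      · exact hxq (hT hpy hpx hadj.symm hpq hqy.symm)
      · rintro rfl
        exact hxy (hT hpq hpx hqz hpy hqy)
      · exact hzp (hT hqy hqz hadj hpq.symm hpy.symm)
      · exact hzy (hT hpq hadj.symm hqz hpy hqy)
      · exact hxy (hT hpq hpx hadj.symm hpy hqy)
  rw [h4]
  have h5 : Finset.card {t : (V × V × V) × (V × V × V) |
      (IsLinkedTriangle G t.1.1 t.1.2.1 t.1.2.2 t.2.1 t.2.2.1 t.2.2.2 ∧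
        G.Adj t.2.1 t.2.2.1) ∧ G.Adj t.1.2.2 t.2.2.2} =
      Finset.card {t : (V × V × V) × (V × V × V) |
      (IsLinkedTriangle G t.1.1 t.1.2.1 t.1.2.2 t.2.1 t.2.2.1 t.2.2.2 ∧
        G.Adj t.1.2.2 t.2.2.2) ∧ G.Adj t.2.1 t.2.2.1} := by
    simp only [and_right_comm]
  have h6 : Finset.card {t : (V × V × V) × (V × V × V) |
      (IsLinkedTriangle G t.1.1 t.1.2.1 t.1.2.2 t.2.1 t.2.2.1 t.2.2.2 ∧
        ¬ G.Adj t.2.1 t.2.2.1) ∧ G.Adj t.1.2.2 t.2.2.2} =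
      Finset.card {t : (V × V × V) × (V × V × V) |
      (IsLinkedTriangle G t.1.1 t.1.2.1 t.1.2.2 t.2.1 t.2.2.1 t.2.2.2 ∧
        G.Adj t.1.2.2 t.2.2.2) ∧ ¬ G.Adj t.2.1 t.2.2.1} := by
    congr 1
    ext t
    rw [Finset.mem_filter, Finset.mem_filter]
    tauto
  rw [h5] at h2
  rw [h6] at h3
  linarith

/-- The path `p q r` determines the frame: `y` and `z` complete the triangles on `pq` and `qr`, and
`x` is the common neighbour of `p, r` other than `q`. -/
theorem SimpleGraph.IsSRGWith.card_hexFrame_two_chords (h : G.IsSRGWith n k 1 2) :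
    (Finset.card {t : (V × V × V) × (V × V × V) |
      IsHexFrame G t.1.1 t.1.2.1 t.1.2.2 t.2.1 t.2.2.1 t.2.2.2 ∧ G.Adj t.2.1 t.2.2.1 ∧
        G.Adj t.2.2.1 t.2.2.2} : ℤ) = n * k * (k - 2) := by
  rw [← h.card_cherry]
  congr 1
  have hT := @SimpleGraph.IsSRGWith.third_unique V _ G _ n k h
  have hO := @SimpleGraph.IsSRGWith.other_unique V _ G _ n k _ h
  refine Finset.card_bij (fun t _ => (t.2.2.1, t.2.1, t.2.2.2)) ?_ ?_ ?_
  · rintro ⟨⟨x, y, z⟩, p, q, r⟩ ht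
    rw [Finset.mem_filter] at ht ⊢
    simp only [Finset.mem_univ, true_and, IsHexFrame, IsIndepTriple, IsCherry] at ht ⊢
    obtain ⟨⟨⟨hxy, hxz, hyz⟩, ⟨hxp, hyp, hzp⟩, ⟨hyq, hzq, hxq⟩, hzr, hxr, hyr⟩, hpq, hqr⟩ := ht
    refine ⟨hpq.symm, hqr, ?_, fun hpr => ?_⟩
    · rintro rfl
      exact hyr hyp
    · obtain rfl := hT hpq hpr hqr hyp.symm hyq.symm
      exact hyz.2 hzr.symm
  · rintro ⟨⟨x, y, z⟩, p, q, r⟩ ht ⟨⟨x', y', z'⟩, p', q', r'⟩ ht' heq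
    rw [Finset.mem_filter] at ht ht'
    simp only [Finset.mem_univ, true_and, IsHexFrame, IsIndepTriple, Prod.mk.injEq] at ht ht' heq
    obtain ⟨rfl, rfl, rfl⟩ := heq
    obtain ⟨⟨⟨hxy, hxz, hyz⟩, ⟨hxp, hyp, hzp⟩, ⟨hyq, hzq, hxq⟩, hzr, hxr, hyr⟩, hpq, hqr⟩ := ht
    obtain ⟨⟨⟨hxy', -, -⟩, ⟨hxp', hyp', -⟩, ⟨hyq', hzq', -⟩, hzr', hxr', -⟩, -, -⟩ := ht'
    obtain rfl := hT hpq hyp.symm hyq.symm hyp'.symm hyq'.symm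
    obtain rfl := hT hqr hzq.symm hzr.symm hzq'.symm hzr'.symm
    have hpr : p ≠ r := by
      rintro rfl
      exact hyr hyp
    have hne : ∀ {a}, ¬ G.Adj a y → a ≠ q := by
      rintro a ha rfl
      exact ha hyq.symm
    obtain rfl := hO hpr hpq hqr.symm hxp.symm hxr.symm hxp'.symm hxr'.symm
      (hne hxy.2) (hne hxy'.2)
    rfl
  · rintro ⟨q, p, r⟩ ht
    rw [Finset.mem_filter] at ht
    obtain ⟨-, hqp, hqr, hrp, hpr⟩ := ht
    dsimp only at hqp hqr hrp hpr
    obtain ⟨y, hqy, hpy⟩ := h.exists_third hqp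
    obtain ⟨z, hqz, hrz⟩ := h.exists_third hqr
    obtain ⟨x, hxq, hpx, hrx⟩ := h.exists_other (a := q) hrp.symm hpr
    refine ⟨((x, y, z), p, q, r), ?_, rfl⟩
    rw [Finset.mem_filter]
    dsimp only
    have hyr : ¬ G.Adj y r := fun hyr => hrp (hT hqy hqr hyr hqp hpy.symm)
    have hzp : ¬ G.Adj z p := fun hzp => hrp (hT hqz hqr hrz.symm hqp hzp)
    have hyr' : y ≠ r := by
      rintro rfl
      exact hpr hpy
    have hxq' : ¬ G.Adj x q := fun hadj => by
      obtain rfl := hT hqp hadj.symm hpx hqy hpy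
      exact hyr hrx.symm
    refine ⟨Finset.mem_univ _, ⟨⟨⟨?_, fun hadj => ?_⟩, ⟨?_, fun hadj => ?_⟩, ⟨?_, fun hadj => ?_⟩⟩,
      ⟨hpx.symm, hpy.symm, hzp⟩, ⟨hqy.symm, hqz.symm, hxq'⟩, hrz.symm, hrx.symm, hyr⟩,
      hqp.symm, hqr⟩
    · rintro rfl
      exact hxq' hqy.symm
    · exact hxq (hT hpy hpx hadj.symm hqp.symm hqy.symm)
    · rintro rfl
      exact hxq' hqz.symm
    · exact hxq (hT hrz hrx hadj.symm hqr.symm hqz.symm)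
    · rintro rfl
      exact hyr hrz.symm
    · exact hyr' (hT hqz hqy hadj.symm hqr hrz.symm)

/-- The number of labelled induced hexagons. -/
theorem SimpleGraph.IsSRGWith.card_hexFrame_no_chords (h : G.IsSRGWith n k 1 2) :
    (Finset.card {t : (V × V × V) × (V × V × V) |
      IsHexFrame G t.1.1 t.1.2.1 t.1.2.2 t.2.1 t.2.2.1 t.2.2.2 ∧ ¬ G.Adj t.2.1 t.2.2.1 ∧
        ¬ G.Adj t.2.2.1 t.2.2.2 ∧ ¬ G.Adj t.2.2.2 t.2.1} : ℤ) =
      n * k * (k - 2) * (2 * k ^ 2 - 21 * k + 53) +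
      3 * Finset.card {t : (V × V × V) × (V × V × V) |
      (IsLinkedTriangle G t.1.1 t.1.2.1 t.1.2.2 t.2.1 t.2.2.1 t.2.2.2 ∧
        G.Adj t.2.1 t.2.2.1) ∧ ¬ G.Adj t.1.2.2 t.2.2.2} := by
  have hrot : ∀ x y z p q r : V, IsHexFrame G x y z p q r → IsHexFrame G y z x q r p := by
    rintro x y z p q r ⟨⟨hxy, hxz, hyz⟩, hp, hq, hr⟩
    exact ⟨⟨hyz, ⟨hxy.1.symm, fun h => hxy.2 h.symm⟩, ⟨hxz.1.symm, fun h => hxz.2 h.symm⟩⟩,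
      hq, hr, hp⟩
  have hcyc : ∀ P Q : V → V → V → Prop, ∀ [∀ p q r, Decidable (P p q r)]
      [∀ p q r, Decidable (Q p q r)], (∀ p q r, P p q r ↔ Q q r p) →
      Finset.card {t : (V × V × V) × (V × V × V) |
        IsHexFrame G t.1.1 t.1.2.1 t.1.2.2 t.2.1 t.2.2.1 t.2.2.2 ∧ P t.2.1 t.2.2.1 t.2.2.2} =
      Finset.card {t : (V × V × V) × (V × V × V) |
        IsHexFrame G t.1.1 t.1.2.1 t.1.2.2 t.2.1 t.2.2.1 t.2.2.2 ∧
          Q t.2.1 t.2.2.1 t.2.2.2} := by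
    intro P Q _ _ hPQ
    refine Finset.card_bij'
      (fun t _ => ((t.1.2.1, t.1.2.2, t.1.1), t.2.2.1, t.2.2.2, t.2.1))
      (fun t _ => ((t.1.2.2, t.1.1, t.1.2.1), t.2.2.2, t.2.1, t.2.2.1)) ?_ ?_
      (fun _ _ => rfl) (fun _ _ => rfl)
    · rintro t ht
      rw [Finset.mem_filter] at ht ⊢
      exact ⟨Finset.mem_univ _, hrot _ _ _ _ _ _ ht.2.1, (hPQ _ _ _).1 ht.2.2⟩
    · rintro t ht
      rw [Finset.mem_filter] at ht ⊢
      exact ⟨Finset.mem_univ _, hrot _ _ _ _ _ _ (hrot _ _ _ _ _ _ ht.2.1),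
        (hPQ _ _ _).2 ht.2.2⟩
  have hie := card_filter_none_of_three (fun t : (V × V × V) × (V × V × V) =>
      IsHexFrame G t.1.1 t.1.2.1 t.1.2.2 t.2.1 t.2.2.1 t.2.2.2)
    (fun t => G.Adj t.2.1 t.2.2.1) (fun t => G.Adj t.2.2.1 t.2.2.2)
    (fun t => G.Adj t.2.2.2 t.2.1) (by
      rintro ⟨⟨x, y, z⟩, p, q, r⟩ ⟨⟨-, -, hyz⟩, ⟨hxp, hyp, -⟩, ⟨hyq, -, -⟩, hzr, -, -⟩ hpq hqr hrp
      dsimp only at *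
      -- With all three chords, `y` and `r` would both complete the triangle on `pq`, but `z` is
      -- adjacent only to `r`.
      obtain rfl := h.third_unique hpq hyp.symm hyq.symm hrp.symm hqr
      exact hyz.2 hzr.symm)
  have e1 := hcyc (fun _ q r => G.Adj q r) (fun p q _ => G.Adj p q) fun _ _ _ => Iff.rfl
  have e2 := hcyc (fun p _ r => G.Adj r p) (fun _ q r => G.Adj q r) fun _ _ _ => Iff.rfl
  have e3 := hcyc (fun p q r => G.Adj q r ∧ G.Adj r p) (fun p q r => G.Adj p q ∧ G.Adj q r)
    fun _ _ _ => Iff.rfl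
  have e4 := hcyc (fun p q r => G.Adj r p ∧ G.Adj p q) (fun p q r => G.Adj q r ∧ G.Adj r p)
    fun _ _ _ => Iff.rfl
  rw [hie, e4, e3, e2, e1, h.card_hexFrame, h.card_hexFrame_chord, h.card_hexFrame_two_chords]
  -- The factor `n` makes the parameter relation hold for the empty graph too, where `k` is
  -- arbitrary.
  have hpar : (n : ℤ) * (2 * (n - k - 1)) = n * (k * (k - 2)) := by
    rcases Nat.eq_zero_or_pos n with rfl | hn
    · simp
    · rw [h.two_mul_card_not_adj hn]
  have hpar' : (n : ℤ) * (2 * n) = n * (k * (k - 2) + 2 * k + 2) := by linear_combination hpar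
  linear_combination (4 * (n - 2 * k : ℤ)) * hpar + (2 * (k * (k - 2)) : ℤ) * hpar'

end HexagonCount

/-! ### Labelled configurations as embeddings. -/

section Labelled

variable {V : Type*} [Fintype V] [DecidableEq V] {G : SimpleGraph V} [DecidableRel G.Adj]
  {n k : ℕ}

theorem twelve_mul_inducedCount_cycleGraph_six :
    12 * inducedCount G (SimpleGraph.cycleGraph 6) =
      Finset.card {t : (V × V × V) × (V × V × V) |
        IsHexFrame G t.1.1 t.1.2.1 t.1.2.2 t.2.1 t.2.2.1 t.2.2.2 ∧ ¬ G.Adj t.2.1 t.2.2.1 ∧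
          ¬ G.Adj t.2.2.1 t.2.2.2 ∧ ¬ G.Adj t.2.2.2 t.2.1} := by
  have hcard := card_embedding_eq_card_aut_mul_inducedCount (G := G)
    (H := SimpleGraph.cycleGraph 6)
  rw [card_aut_cycleGraph_six] at hcard
  rw [mul_comm, ← hcard, Nat.card_congr (embeddingEquivOfTwinFree (by decide)),
    ← Fintype.card_subtype, ← Nat.card_eq_fintype_card]
  refine Nat.card_congr
    { toFun := fun f => ⟨((f.1 0, f.1 2, f.1 4), f.1 1, f.1 3, f.1 5), ?_⟩
      invFun := fun t => ⟨![t.1.1.1, t.1.2.1, t.1.1.2.1, t.1.2.2.1, t.1.1.2.2, t.1.2.2.2], ?_⟩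
      left_inv := ?_
      right_inv := fun t => rfl }
  · obtain ⟨f, hf⟩ := f
    have hpos : ∀ {i j}, (SimpleGraph.cycleGraph 6).Adj i j → G.Adj (f i) (f j) :=
      fun hij => (hf _ _).2 hij
    have hneg : ∀ {i j}, ¬ (SimpleGraph.cycleGraph 6).Adj i j → ¬ G.Adj (f i) (f j) :=
      fun hij hadj => hij ((hf _ _).1 hadj)
    have hne : ∀ {i j} l, (SimpleGraph.cycleGraph 6).Adj i l →
        ¬ (SimpleGraph.cycleGraph 6).Adj j l → f i ≠ f j :=
      fun l h1 h2 heq => hneg h2 (heq ▸ hpos h1)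
    exact ⟨⟨⟨⟨hne 5 (by decide) (by decide), hneg (by decide)⟩,
      ⟨hne 1 (by decide) (by decide), hneg (by decide)⟩,
      ⟨hne 1 (by decide) (by decide), hneg (by decide)⟩⟩,
      ⟨hpos (by decide), hpos (by decide), hneg (by decide)⟩,
      ⟨hpos (by decide), hpos (by decide), hneg (by decide)⟩,
      ⟨hpos (by decide), hpos (by decide), hneg (by decide)⟩⟩,
      hneg (by decide), hneg (by decide), hneg (by decide)⟩
  · obtain ⟨⟨⟨x, y, z⟩, p, q, r⟩, ⟨⟨⟨-, hxy⟩, ⟨-, hxz⟩, -, hyz⟩, ⟨hxp, hyp, hzp⟩,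
      ⟨hyq, hzq, hxq⟩, hzr, hxr, hyr⟩, hpq, hqr, hrp⟩ := t
    dsimp only at *
    intro a b
    fin_cases a <;> fin_cases b <;>
      simp [hxy, hxz, hyz, hxp, hyp, hzp, hyq, hzq, hxq, hzr, hxr, hyr, hpq, hqr, hrp,
        G.adj_comm y x, G.adj_comm z x, G.adj_comm z y, G.adj_comm p x, G.adj_comm p y,
        G.adj_comm p z, G.adj_comm q x, G.adj_comm q y, G.adj_comm q z, G.adj_comm r x,
        G.adj_comm r y, G.adj_comm r z, G.adj_comm q p, G.adj_comm r q, G.adj_comm p r] <;> decide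
  · rintro ⟨f, hf⟩
    ext a
    fin_cases a <;> rfl

theorem SimpleGraph.IsSRGWith.four_mul_inducedCount_doublyLinkedTriangles
    (h : G.IsSRGWith n k 1 2) :
    4 * inducedCount G doublyLinkedTriangles =
      Finset.card {t : (V × V × V) × (V × V × V) |
        (IsLinkedTriangle G t.1.1 t.1.2.1 t.1.2.2 t.2.1 t.2.2.1 t.2.2.2 ∧
          G.Adj t.2.1 t.2.2.1) ∧ ¬ G.Adj t.1.2.2 t.2.2.2} := by
  have hT := @SimpleGraph.IsSRGWith.third_unique V _ G _ n k h
  have hcard := card_embedding_eq_card_aut_mul_inducedCount (G := G)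
    (H := doublyLinkedTriangles)
  rw [card_aut_doublyLinkedTriangles] at hcard
  rw [mul_comm, ← hcard, Nat.card_congr (embeddingEquivOfTwinFree (by decide)),
    ← Fintype.card_subtype, ← Nat.card_eq_fintype_card]
  refine Nat.card_congr
    { toFun := fun f => ⟨((f.1 0, f.1 1, f.1 2), f.1 3, f.1 4, f.1 5), ?_⟩
      invFun := fun t => ⟨![t.1.1.1, t.1.1.2.1, t.1.1.2.2, t.1.2.1, t.1.2.2.1, t.1.2.2.2], ?_⟩
      left_inv := ?_
      right_inv := fun t => rfl }
  · obtain ⟨f, hf⟩ := f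
    have hpos : ∀ {i j}, doublyLinkedTriangles.Adj i j → G.Adj (f i) (f j) :=
      fun hij => (hf _ _).2 hij
    have hneg : ∀ {i j}, ¬ doublyLinkedTriangles.Adj i j → ¬ G.Adj (f i) (f j) :=
      fun hij hadj => hij ((hf _ _).1 hadj)
    have hne : ∀ {i j} l, doublyLinkedTriangles.Adj i l →
        ¬ doublyLinkedTriangles.Adj j l → f i ≠ f j :=
      fun l h1 h2 heq => hneg h2 (heq ▸ hpos h1)
    exact ⟨⟨⟨⟨hpos (by decide), hpos (by decide), hpos (by decide)⟩,
      ⟨hpos (by decide), hne 5 (by decide) (by decide), hne 5 (by decide) (by decide)⟩,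
      ⟨hpos (by decide), hne 5 (by decide) (by decide), hne 5 (by decide) (by decide)⟩,
      hpos (by decide), hpos (by decide)⟩, hpos (by decide)⟩, hneg (by decide)⟩
  · obtain ⟨⟨⟨p, q, y⟩, x, z, r⟩, ⟨⟨⟨hpq, hqy, hpy⟩, ⟨hpx, hxq, hxy⟩, ⟨hqz, hzp, hzy⟩,
      hxr, hzr⟩, hxz⟩, hyr⟩ := t
    dsimp only at *
    -- Uniqueness of triangles forces all non-edges except `yr`: any of these six edges would
    -- identify two distinct vertices.
    have hpz : ¬ G.Adj p z := fun hadj => hzy (hT hpq hadj hqz hpy hqy)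
    have hqx : ¬ G.Adj q x := fun hadj => hxy (hT hpq hpx hadj hpy hqy)
    have hpr : ¬ G.Adj p r := fun hadj => hzp (hT hxr hxz hzr.symm hpx.symm hadj.symm)
    have hqr : ¬ G.Adj q r := fun hadj => hxq (hT hzr hxz.symm hxr.symm hqz.symm hadj.symm)
    have hyx : ¬ G.Adj y x := fun hadj => hxq (hT hpy hpx hadj hpq hqy.symm)
    have hyz : ¬ G.Adj y z := fun hadj => hzp (hT hqy hqz hadj hpq.symm hpy.symm)
    intro a b
    fin_cases a <;> fin_cases b <;>
      simp [hpq, hqy, hpy, hpx, hqz, hxr, hzr, hxz, hyr, hpz, hqx, hpr, hqr, hyx, hyz,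
        G.adj_comm q p, G.adj_comm y p, G.adj_comm y q, G.adj_comm x p, G.adj_comm x q,
        G.adj_comm x y, G.adj_comm z p, G.adj_comm z q, G.adj_comm z y, G.adj_comm r p,
        G.adj_comm r q, G.adj_comm r y, G.adj_comm z x, G.adj_comm r x, G.adj_comm r z] <;> decide
  · rintro ⟨f, hf⟩
    ext a
    fin_cases a <;> rfl

end Labelled

theorem mainTheorem1 {V : Type*} [Fintype V] [DecidableEq V]
    (G : SimpleGraph V) [DecidableRel G.Adj]
    (hI : EdgesInUniqueTriangle G) (hII : NonEdgesInUniqueQuadrilateral G) :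
    ∃ k : ℕ, G.IsSRGWith (Fintype.card V) k 1 2 ∧
      (inducedCount G (SimpleGraph.cycleGraph 6) : ℚ) =
        1 / 12 * (Fintype.card V : ℚ) * k * (k - 2) * (2 * (k : ℚ) ^ 2 - 21 * k + 53)
          + inducedCount G doublyLinkedTriangles ∧
      1 / 12 * (Fintype.card V : ℚ) * k * (k - 2) * (2 * (k : ℚ) ^ 2 - 21 * k + 53)
        ≤ inducedCount G (SimpleGraph.cycleGraph 6) := by
  obtain ⟨k, h⟩ := exists_isSRGWith hI hII
  have hcount := h.card_hexFrame_no_chords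
  rw [← twelve_mul_inducedCount_cycleGraph_six,
    ← h.four_mul_inducedCount_doublyLinkedTriangles] at hcount
  have hcountQ := congrArg (Int.cast : ℤ → ℚ) hcount
  push_cast at hcountQ
  have heq : (inducedCount G (SimpleGraph.cycleGraph 6) : ℚ) =
      1 / 12 * (Fintype.card V : ℚ) * k * (k - 2) * (2 * (k : ℚ) ^ 2 - 21 * k + 53)
        + inducedCount G doublyLinkedTriangles := by
    linear_combination hcountQ / 12
  exact ⟨k, h, heq, heq ▸ le_add_of_nonneg_right (Nat.cast_nonneg _)⟩
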